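/- Let $a=(a_0,a_1,\dots)\in\mathbb R^{\mathbb N}$ ($\mathbb N=\{0,1,2,\dots\}$), let $G[a]=\sum_{k\ge 0}a_kx^k$ be its (formal) generating function and let $T[a]$ be the infinite lower-triangular Toeplitz matrix with $T_{i,j}=a_{i-j}$ for $i\ge j$ and $T_{i,j}=0$ for $i<j$. Call $G[a]$ irrational if there are no real polynomials $P,Q$ with $Q(0)\ne 0$ and $Q\cdot G[a]=P$. A streaming algorithm with buffer size $\beta:\{-1\}\cup\mathbb N\to\mathbb N$, $\beta(-1)=1$, consists of maps $u^{(t)}:\mathbb R^{\beta(t-1)}\times\mathbb R\to\mathbb R^{\beta(t)}$ and $m^{(t)}:\mathbb R^{\beta(t)}\to\mathbb R$ for $t\in\mathbb N$. On a stream $z\in\mathbb R^{\mathbb N}$ its states are $s^{(-1)}=0$ and $s^{(t)}=u^{(t)}(s^{(t-1)},z_t)$, and for each $t$ the map $(z_0,\dots,z_t)\mapsto s^{(t)}$ is required to be continuous (the maps $m^{(t)}$ need not be). It solves the streaming problem of $T[a]$ on infinite streams if $m^{(t)}(s^{(t)})=(T[a]z)_t$ for every $z$ and every $t\in\mathbb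 N$. Let $\mathsf{space}_a(t)$ be the minimum $b$ such that some streaming algorithm solves the streaming problem of $T[a]$ on infinite streams and satisfies $\beta(t')\le b$ for all $0\le t'\le t$. **Theorem.** If $G[a]$ is irrational, then $\mathsf{space}_a(t)=t+1$ for every $t\in\mathbb N$. In particular, no streaming algorithm with bounded buffer size solves the streaming problem of $T[a]$ on infinite streams. -/

import Mathlib

/-- The length `β(t-1)` of the state just before time `t`, where `β(-1) = 1`. -/
def previousSize (β : ℕ → ℕ) : ℕ → ℕ
  | 0 => 1
  | t + 1 => β t

/-- A streaming algorithm over the reals. `bufferSize t` is `β(t)` for the times `t = 0, 1, 2, …`;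
the state before the first input (time `-1`) is the zero vector of length `β(-1) = 1`.
The update and output maps are arbitrary functions; the continuity assumption is `IsContinuous`. -/
structure StreamingMaps where
  /-- the buffer size `β(t)`, for `t ≥ 0` -/
  bufferSize : ℕ → ℕ
  /-- `u^(t) : ℝ^β(t-1) × ℝ → ℝ^β(t)`, where `β(-1) = 1` -/
  update : (t : ℕ) → (Fin (previousSize bufferSize t) → ℝ) → ℝ → (Fin (bufferSize t) → ℝ)
  /-- `m^(t) : ℝ^β(t) → ℝ` -/
  output : (t : ℕ) → (Fin (bufferSize t) → ℝ) → ℝ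

namespace StreamingMaps

/-- The state just before the input `z t` arrives, that is, the state at time `t - 1`. -/
def stateBefore (A : StreamingMaps) (z : ℕ → ℝ) :
    (t : ℕ) → (Fin (previousSize A.bufferSize t) → ℝ)
  | 0 => 0
  | t + 1 => A.update t (A.stateBefore z t) (z t)

/-- The state at time `t`: `s^(t) = u^(t)(s^(t-1), z t)`. -/
def state (A : StreamingMaps) (z : ℕ → ℝ) (t : ℕ) : Fin (A.bufferSize t) → ℝ :=
  A.update t (A.stateBefore z t) (z t)

/-- The infinite stream that starts with the finite stream `z` and continues with zeros. -/
def extendByZero {n : ℕ} (z : Fin n → ℝ) : ℕ → ℝ :=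
  fun i => if h : i < n then z ⟨i, h⟩ else 0

/-- For each `t`, the state at time `t` is a continuous function of `(z_0, …, z_t)`.
(The state at time `t` does not depend on the later entries of the stream.) -/
def IsContinuous (A : StreamingMaps) : Prop :=
  ∀ t : ℕ, Continuous (fun z : Fin (t + 1) → ℝ => A.state (extendByZero z) t)

end StreamingMaps

/-- A streaming algorithm: update and output maps whose state maps are continuous. -/
structure StreamingAlgorithm extends StreamingMaps where
  continuous_state : toStreamingMaps.IsContinuous

/-- The algorithm computes `M` correctly up to time `τ` (for all times if `τ = ⊤`): on every
stream `z`, its output at each time `t ≤ τ` is `(M z)_t = ∑ j, M t j * z j`. For a matrix with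
finitely many non-zero entries in each row this is a finite sum. -/
def StreamingAlgorithm.SolvesUpTo (A : StreamingAlgorithm) (M : Matrix ℕ ℕ ℝ) (τ : ℕ∞) : Prop :=
  ∀ (z : ℕ → ℝ) (t : ℕ), (t : ℕ∞) ≤ τ →
    HasSum (fun j : ℕ => M t j * z j) (A.output t (A.state z t))

/-- `space_M(t; τ)`: the least `b` such that some streaming algorithm computes `M` correctly up to
time `τ` with `β(t') ≤ b` for all times `t' ≤ t` (it is `⊤` if there is no such algorithm). -/
noncomputable def streamSpace (M : Matrix ℕ ℕ ℝ) (t : ℕ) (τ : ℕ∞) : ℕ∞ :=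
  sInf {b : ℕ∞ | ∃ A : StreamingAlgorithm, A.SolvesUpTo M τ ∧
    ∀ t' ≤ t, (A.bufferSize t' : ℕ∞) ≤ b}

/-- The lower-triangular Toeplitz matrix `T[a]`. -/
def toeplitz (a : ℕ → ℝ) : Matrix ℕ ℕ ℝ :=
  Matrix.of fun i j => if j ≤ i then a (i - j) else 0

/-- `G` is a rational function of degree at most `d`: `Q * G = P` for polynomials `P`, `Q` with
`Q(0) ≠ 0`, `deg Q ≤ d` and `deg P ≤ d - 1` (so `P = 0` if `d = 0`). -/
def PowerSeries.IsRationalOfDegreeLE (G : PowerSeries ℝ) (d : ℕ) : Prop :=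
  ∃ P Q : Polynomial ℝ, Q.coeff 0 ≠ 0 ∧ Q.degree ≤ (d : WithBot ℕ) ∧ P.degree < (d : WithBot ℕ) ∧
    (Q : PowerSeries ℝ) * G = (P : PowerSeries ℝ)

/-- `G` is irrational: it is not a rational function of any degree. -/
def PowerSeries.IsIrrational (G : PowerSeries ℝ) : Prop :=
  ¬ ∃ d : ℕ, G.IsRationalOfDegreeLE d

/-!
The upper bound is attained by storing the whole stream. For the lower bound let an algorithm
solve the streaming problem of `T[a]`. If two inputs up to time `t` led to the same state, then,
continued by zeros, they would give the same outputs from time `t` on. The difference `W` of their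
generating polynomials would then satisfy `W * G[a] = P` for a polynomial `P`, and `G[a]` would be
rational (`PowerSeries.exists_isRationalOfDegreeLE_of_coeff_mul_eq_zero`). So the state at time `t`
is a continuous injective function from `ℝ^(t+1)` to `ℝ^β(t)`, and `t + 1 ≤ β(t)` by invariance of
dimension (`not_injective_of_continuous_of_finrank_lt`).

Invariance of dimension is proved analytically, in the manner of the Milnor–Rogers proof of
Brouwer's fixed point theorem. A continuous injection `f` of a ball into a smaller space has a
continuous left inverse on its image; approximating both by `C¹` maps gives a `C¹` map `H` of the
larger space that is close to the identity on the ball and has a singular derivative everywhere.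
Such a map does not exist (`exists_det_fderiv_ne_zero_of_norm_sub_le`). Indeed, let `x ↦ x + V x`
be `H` cut off to be the identity far out. For small `t`, `x ↦ x + t V x` is a diffeomorphism of a
ball, so that `∫ det(1 + t V'(x)) ψ(x + t V x) = ∫ ψ(x)`. For polynomial `ψ` the left-hand side is
a polynomial in `t`, so the identity persists at `t = 1`
(`integral_pow_sub_norm_sq_mul_det_eq`). There the integrand vanishes wherever `H` is not cut off,
which is impossible if `ψ` is concentrated near the origin.
-/

/-! ### Change of variables for perturbations of the identity -/

theorem ContinuousLinearMap.exists_polynomial_eval_eq_det_one_add_smul {E : Type*}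
    [NormedAddCommGroup E] [NormedSpace ℝ E] [FiniteDimensional ℝ E] (A : E →L[ℝ] E) :
    ∃ p : Polynomial ℝ, p.natDegree ≤ Module.finrank ℝ E ∧ ∀ t : ℝ, p.eval t = (1 + t • A).det := by
  let b := Module.finBasis ℝ E
  let M := LinearMap.toMatrix b b (A : E →ₗ[ℝ] E)
  refine ⟨((Polynomial.X : Polynomial ℝ) • M.map Polynomial.C +
    (1 : Matrix _ _ ℝ).map Polynomial.C).det, ?_, fun t => ?_⟩
  · simpa using Polynomial.natDegree_det_X_add_C_le M 1
  · rw [ContinuousLinearMap.det, ← LinearMap.det_toMatrix b, ← Polynomial.coe_evalRingHom,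
      RingHom.map_det]
    congr 1
    have hone : LinearMap.toMatrix b b ((1 + t • A : E →L[ℝ] E) : E →ₗ[ℝ] E) = 1 + t • M := by
      rw [ContinuousLinearMap.toLinearMap_add, ContinuousLinearMap.toLinearMap_smul, map_add, map_smul]
      congr 1
      exact LinearMap.toMatrix_one b
    rw [hone]
    ext i j
    simp [Matrix.one_apply, apply_ite, add_comm]
    exact mul_comm _ _

/-- If the integrand is a polynomial of bounded degree in the parameter `t`, then an integral that
is constant for small `t > 0` is constant for all `t`. By Lagrange interpolation the integral is
itself a polynomial in `t`, so no regularity of the coefficients has to be discussed. -/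
theorem integral_eq_of_forall_polynomial {α : Type*} [MeasurableSpace α]
    {μ : MeasureTheory.Measure α} {q : ℝ → α → ℝ} {D : ℕ} {c δ : ℝ} (hδ : 0 < δ)
    (hq : ∀ x, ∃ p : Polynomial ℝ, p.natDegree ≤ D ∧ ∀ t, p.eval t = q t x)
    (hint : ∀ t, MeasureTheory.Integrable (q t) μ)
    (hc : ∀ t, 0 < t → t < δ → ∫ x, q t x ∂μ = c) (t : ℝ) : ∫ x, q t x ∂μ = c := by
  classical
  let s := Finset.range (D + 1)
  let v : ℕ → ℝ := fun i => i
  have hv : Set.InjOn v s := fun i _ j _ h => by simpa [v] using h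
  have hpoly : ∀ t, ∫ x, q t x ∂μ =
      (Lagrange.interpolate s v fun i => ∫ x, q (v i) x ∂μ).eval t := by
    intro t
    have hx : ∀ x, q t x = ∑ i ∈ s, q (v i) x * (Lagrange.basis s v i).eval t := by
      intro x
      obtain ⟨p, hpD, hp⟩ := hq x
      have hdeg : p.degree < s.card := by
        refine lt_of_le_of_lt Polynomial.degree_le_natDegree ?_
        simp only [s, Finset.card_range]
        exact_mod_cast Nat.lt_succ_of_le hpD
      rw [← hp, Lagrange.eq_interpolate hv hdeg]
      simp [Lagrange.interpolate_apply, Polynomial.eval_finsetSum, hp]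
    simp_rw [hx]
    rw [MeasureTheory.integral_finsetSum _ fun i _ => (hint _).mul_const _]
    simp [Lagrange.interpolate_apply, Polynomial.eval_finsetSum,
      MeasureTheory.integral_mul_const]
  have hconst : (Lagrange.interpolate s v fun i => ∫ x, q (v i) x ∂μ) = Polynomial.C c := by
    refine Polynomial.eq_of_infinite_eval_eq _ _ ((Set.Ioo_infinite hδ).mono fun t ht => ?_)
    simp only [Set.mem_ofPred_eq, Polynomial.eval_C]
    rw [← hpoly, hc t ht.1 ht.2]
  rw [hpoly, hconst, Polynomial.eval_C]

open MeasureTheory Metric in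
/-- For small `t`, the map `x ↦ x + t V x`, with `V` supported in a ball, is an
orientation-preserving diffeomorphism of that ball, and the change of variables formula holds. -/
theorem exists_forall_integral_det_one_add_smul_mul_comp {E : Type*} [NormedAddCommGroup E]
    [NormedSpace ℝ E] [FiniteDimensional ℝ E] [MeasurableSpace E] [BorelSpace E]
    (μ : Measure E) [μ.IsAddHaarMeasure] {V : E → E} (hV : ContDiff ℝ 1 V) {R : ℝ}
    (hR : ∀ x, R < ‖x‖ → V x = 0) :
    ∃ δ : ℝ, 0 < δ ∧ ∀ t : ℝ, 0 < t → t < δ → ∀ ψ : E → ℝ,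
      ∫ x in closedBall 0 R, (1 + t • fderiv ℝ V x).det * ψ (x + t • V x) ∂μ =
        ∫ x in closedBall 0 R, ψ x ∂μ := by
  have hsupp : HasCompactSupport V :=
    HasCompactSupport.intro (isCompact_closedBall (0 : E) R) fun x hx => hR x (by simpa using hx)
  obtain ⟨C, hC⟩ := ContDiff.lipschitzWith_of_hasCompactSupport hsupp hV one_ne_zero
  refine ⟨1 / (C + 1), by positivity, fun t ht0 ht ψ => ?_⟩
  have htC : t * C < 1 := by
    rw [lt_div_iff₀ (by positivity)] at ht
    nlinarith
  have hbound : ∀ x, ‖fderiv ℝ V x‖ ≤ C := fun x => norm_fderiv_le_of_lipschitz ℝ hC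
  -- `x ↦ x + t V x` is a Lipschitz perturbation of the identity, with constant `t C < 1`, hence
  -- a homeomorphism of the whole space.
  have happ : ApproximatesLinearOn (fun x => x + t • V x)
      ((ContinuousLinearEquiv.refl ℝ E : E ≃L[ℝ] E) : E →L[ℝ] E) Set.univ
      (⟨t, ht0.le⟩ * C) := by
    intro x _ y _
    have h1 : x + t • V x - (y + t • V y) -
        ((ContinuousLinearEquiv.refl ℝ E : E ≃L[ℝ] E) : E →L[ℝ] E) (x - y) =
        t • (V x - V y) := by
      simp only [ContinuousLinearEquiv.coe_refl, ContinuousLinearMap.id_apply, smul_sub]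
      abel
    rw [h1, norm_smul, Real.norm_of_nonneg ht0.le]
    have := hC.dist_le_mul x y
    rw [dist_eq_norm, dist_eq_norm] at this
    calc t * ‖V x - V y‖ ≤ t * (C * ‖x - y‖) := by gcongr
      _ = t * C * ‖x - y‖ := by ring
  have hlt : Subsingleton E ∨ (⟨t, ht0.le⟩ * C : NNReal) <
      ‖((ContinuousLinearEquiv.refl ℝ E : E ≃L[ℝ] E).symm : E →L[ℝ] E)‖₊⁻¹ := by
    rcases subsingleton_or_nontrivial E with h | h
    · exact Or.inl h
    · right
      have : ‖((ContinuousLinearEquiv.refl ℝ E : E ≃L[ℝ] E).symm : E →L[ℝ] E)‖₊ = 1 := by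
        ext; simp
      rw [this, inv_one, ← NNReal.coe_lt_coe]
      exact htC
  let Φ := happ.toHomeomorph _ hlt
  have hΦ : ∀ x, Φ x = x + t • V x := fun x => rfl
  -- It fixes every point outside the ball, so it maps the ball onto itself.
  have himage : (fun x => x + t • V x) '' closedBall 0 R = closedBall 0 R := by
    have hcompl : ∀ x, R < ‖x‖ → Φ x = x := fun x hx => by simp [hΦ, hR x hx]
    apply Set.Subset.antisymm
    · rintro _ ⟨x, hx, rfl⟩
      by_contra hy
      have hy' : R < ‖Φ x‖ := by simpa [hΦ] using hy
      have := Φ.injective (hcompl _ hy')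
      rw [this] at hy'
      simp at hx
      linarith
    · intro y hy
      obtain ⟨x, rfl⟩ := Φ.surjective y
      refine ⟨x, ?_, rfl⟩
      by_contra hx
      have hx' : R < ‖x‖ := by simpa using hx
      rw [hcompl x hx'] at hy
      exact hx hy
  have hderiv : ∀ x, HasFDerivAt (fun x => x + t • V x) (1 + t • fderiv ℝ V x) x := fun x =>
    (hasFDerivAt_id x).add (((hV.differentiable one_ne_zero x).hasFDerivAt).const_smul t)
  have hne : ∀ A : E →L[ℝ] E, ‖A‖ < 1 → (1 + A).det ≠ 0 := by
    intro A hA h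
    have hu : IsUnit (1 - -A) := isUnit_one_sub_of_norm_lt_one (by simpa using hA)
    rw [sub_neg_eq_add] at hu
    obtain ⟨B, hB⟩ := hu.exists_right_inv
    have hdet : LinearMap.det ((1 + A : E →L[ℝ] E) : E →ₗ[ℝ] E) * LinearMap.det (B : E →ₗ[ℝ] E)
        = 1 := by
      rw [← LinearMap.det_comp, ← ContinuousLinearMap.toLinearMap_comp,
        ← ContinuousLinearMap.mul_def, hB]
      simp
    exact left_ne_zero_of_mul_eq_one hdet h
  -- The determinant does not vanish on the unit ball around the identity, which is connected, so
  -- it is positive there, and the absolute value in the change of variables formula can go.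
  have hpos : ∀ x, 0 < (1 + t • fderiv ℝ V x).det := by
    intro x
    have hconn : IsPreconnected (ball (0 : E →L[ℝ] E) 1) := (convex_ball _ _).isPreconnected
    have hcont : ContinuousOn (fun A : E →L[ℝ] E => (1 + A).det) (ball 0 1) :=
      (ContinuousLinearMap.continuous_det.comp (continuous_const.add continuous_id)).continuousOn
    have hmem : t • fderiv ℝ V x ∈ ball (0 : E →L[ℝ] E) 1 := by
      rw [mem_ball_zero_iff, norm_smul, Real.norm_of_nonneg ht0.le]
      exact lt_of_le_of_lt (by gcongr; exact hbound x) htC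
    by_contra hle
    obtain ⟨A, hA, hA0⟩ := hconn.intermediate_value hmem (mem_ball_self one_pos) hcont
      ⟨not_lt.1 hle, by simp [ContinuousLinearMap.det]⟩
    exact hne A (by simpa using hA) hA0
  have := integral_image_eq_integral_abs_det_fderiv_smul μ
    (measurableSet_closedBall : MeasurableSet (closedBall (0 : E) R))
    (fun x _ => (hderiv x).hasFDerivWithinAt) (Φ.injective.injOn) ψ
  rw [himage] at this
  rw [this]
  simp only [abs_of_pos (hpos _), smul_eq_mul]

open MeasureTheory Metric in
/-- The change of variables formula for `x ↦ x + V x` and the test function `(c - ‖y‖²)^N`, for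
a perturbation `V` of any size. The map need not be injective: along `x ↦ x + t V x` both sides
agree for small `t`, and the left-hand side is a polynomial in `t`. -/
theorem integral_pow_sub_norm_sq_mul_det_eq {E : Type*} [NormedAddCommGroup E]
    [InnerProductSpace ℝ E] [FiniteDimensional ℝ E] [MeasurableSpace E] [BorelSpace E]
    (μ : Measure E) [μ.IsAddHaarMeasure] {V : E → E} (hV : ContDiff ℝ 1 V) {R : ℝ}
    (hR : ∀ x, R < ‖x‖ → V x = 0) (c : ℝ) (N : ℕ) :
    ∫ x in closedBall 0 R, (1 + fderiv ℝ V x).det * (c - ‖x + V x‖ ^ 2) ^ N ∂μ =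
      ∫ x in closedBall 0 R, (c - ‖x‖ ^ 2) ^ N ∂μ := by
  obtain ⟨δ, hδ, h⟩ := exists_forall_integral_det_one_add_smul_mul_comp μ hV hR
  have hmain := integral_eq_of_forall_polynomial (μ := μ.restrict (closedBall 0 R))
    (q := fun t x => (1 + t • fderiv ℝ V x).det * (c - ‖x + t • V x‖ ^ 2) ^ N)
    (D := Module.finrank ℝ E + N * 2) hδ ?_ ?_
    (fun t h0 h1 => h t h0 h1 fun y => (c - ‖y‖ ^ 2) ^ N) 1
  · simpa using hmain
  · intro x
    obtain ⟨p, hpD, hp⟩ :=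
      (fderiv ℝ V x).exists_polynomial_eval_eq_det_one_add_smul
    refine ⟨p * (Polynomial.C (c - ‖x‖ ^ 2) - Polynomial.C (2 * inner ℝ x (V x)) * Polynomial.X
      - Polynomial.C (‖V x‖ ^ 2) * Polynomial.X ^ 2) ^ N, ?_, fun t => ?_⟩
    · refine Polynomial.natDegree_mul_le.trans (add_le_add hpD ?_)
      refine Polynomial.natDegree_pow_le.trans (Nat.mul_le_mul_left N ?_)
      compute_degree
    · simp only [Polynomial.eval_mul, hp, Polynomial.eval_pow, Polynomial.eval_sub,
        Polynomial.eval_C, Polynomial.eval_X]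
      rw [norm_add_sq_real, inner_smul_right, norm_smul, mul_pow, Real.norm_eq_abs, sq_abs]
      ring
  · intro t
    have hcont : Continuous fun x => (1 + t • fderiv ℝ V x).det * (c - ‖x + t • V x‖ ^ 2) ^ N := by
      have h1 : Continuous fun x => (1 + t • fderiv ℝ V x).det :=
        ContinuousLinearMap.continuous_det.comp
          (continuous_const.add ((hV.continuous_fderiv one_ne_zero).const_smul t))
      have h2 := hV.continuous
      fun_prop
    exact hcont.continuousOn.integrableOn_compact (isCompact_closedBall _ _)

open MeasureTheory Metric in
/-- A `C¹` map close to the identity on a ball is not singular everywhere on a smaller ball.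
Cut off to be the identity far out, a singular map would contribute to the integral of
`(9 - ‖y‖²)^N` only from points whose image stays away from `0`, whereas for large `N` the mass
of `(9 - ‖y‖²)^N` is concentrated near `0`. -/
theorem exists_det_fderiv_ne_zero_of_norm_sub_le {E : Type*} [NormedAddCommGroup E]
    [InnerProductSpace ℝ E] [FiniteDimensional ℝ E] {H : E → E} (hH : ContDiff ℝ 1 H)
    (hclose : ∀ x, ‖x‖ ≤ 2 → ‖H x - x‖ ≤ 1 / 2) :
    ∃ x, ‖x‖ < 1 ∧ (fderiv ℝ H x).det ≠ 0 := by
  by_contra! hdet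
  borelize E
  let μ : Measure E := Measure.addHaar
  let φ : ContDiffBump (0 : E) := ⟨1, 2, one_pos, one_lt_two⟩
  let V : E → E := fun x => φ x • (H x - x)
  have hV : ContDiff ℝ 1 V := φ.contDiff.smul (hH.sub contDiff_id)
  have hR : ∀ x, (2 : ℝ) < ‖x‖ → V x = 0 := fun x hx => by
    simp only [V]
    rw [φ.zero_of_le_dist (by simpa [φ] using hx.le), zero_smul]
  have hVle : ∀ x, ‖x‖ ≤ 2 → ‖V x‖ ≤ 1 / 2 := by
    intro x hx
    simp only [V, norm_smul, Real.norm_of_nonneg φ.nonneg]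
    calc φ x * ‖H x - x‖ ≤ 1 * (1 / 2) := by
          gcongr
          · exact φ.le_one
          · exact hclose x hx
      _ = 1 / 2 := one_mul _
  have hzero : ∀ x, ‖x‖ < 1 → (1 + fderiv ℝ V x).det = 0 := by
    intro x hx
    have hev : V =ᶠ[nhds x] fun y => H y - y := by
      filter_upwards [isOpen_ball.mem_nhds (show x ∈ ball (0 : E) 1 by simpa using hx)] with y hy
      simp only [V]
      rw [φ.one_of_mem_closedBall (ball_subset_closedBall hy), one_smul]
    rw [hev.fderiv_eq, fderiv_fun_sub (hH.differentiable one_ne_zero x) differentiableAt_fun_id]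
    simpa [fderiv_fun_id, ContinuousLinearMap.one_def] using hdet x hx
  have hcd : Continuous fun x => (1 + fderiv ℝ V x).det :=
    ContinuousLinearMap.continuous_det.comp
      (continuous_const.add (hV.continuous_fderiv one_ne_zero))
  obtain ⟨M, hM⟩ := (isCompact_closedBall (0 : E) 2).exists_bound_of_continuousOn hcd.continuousOn
  -- Where the determinant is not zero, `1 ≤ ‖x‖` and so `1/2 ≤ ‖x + V x‖ ≤ 5/2`, and
  -- `|9 - ‖x + V x‖²| ≤ 9 - 1/4 = 35/4`.
  have hupper : ∀ N : ℕ, ∫ x in closedBall 0 2, (1 + fderiv ℝ V x).det *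
      (9 - ‖x + V x‖ ^ 2) ^ N ∂μ ≤ M * (35 / 4) ^ N * μ.real (closedBall 0 2) := by
    intro N
    refine (le_abs_self _).trans ?_
    rw [← Real.norm_eq_abs]
    refine norm_setIntegral_le_of_norm_le_const measure_closedBall_lt_top fun x hx => ?_
    have hM0 : 0 ≤ M := (norm_nonneg _).trans (hM x hx)
    rw [norm_mul, norm_pow]
    have hx2 : ‖x‖ ≤ 2 := by simpa using hx
    by_cases h1 : ‖x‖ < 1
    · rw [hzero x h1]
      simp only [norm_zero, zero_mul]
      positivity
    · have hle : ‖x + V x‖ ≤ 5 / 2 := (norm_add_le _ _).trans (by linarith [hVle x hx2])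
      have hge : 1 / 2 ≤ ‖x + V x‖ := by
        have := norm_sub_norm_le x (-V x)
        rw [sub_neg_eq_add, norm_neg] at this
        linarith [hVle x hx2]
      gcongr
      · exact hM x hx
      · rw [Real.norm_eq_abs, abs_le]
        constructor <;> nlinarith
  -- On the ball of radius `1/4`, `9 - ‖x‖² ≥ 9 - 1/16 = 143/16`, which exceeds `35/4 = 140/16`.
  have hlower : ∀ N : ℕ, (143 / 16) ^ N * μ.real (closedBall 0 (1 / 4)) ≤
      ∫ x in closedBall 0 2, (9 - ‖x‖ ^ 2) ^ N ∂μ := by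
    intro N
    have hint : IntegrableOn (fun x : E => (9 - ‖x‖ ^ 2) ^ N) (closedBall 0 2) μ :=
      (by fun_prop : Continuous fun x : E => (9 - ‖x‖ ^ 2) ^ N).continuousOn.integrableOn_compact
        (isCompact_closedBall _ _)
    have hsub : closedBall (0 : E) (1 / 4) ⊆ closedBall 0 2 :=
      closedBall_subset_closedBall (by norm_num)
    calc (143 / 16) ^ N * μ.real (closedBall 0 (1 / 4))
        = ∫ x in closedBall (0 : E) (1 / 4), (143 / 16 : ℝ) ^ N ∂μ := by
          rw [setIntegral_const, smul_eq_mul, mul_comm]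
      _ ≤ ∫ x in closedBall 0 (1 / 4), (9 - ‖x‖ ^ 2) ^ N ∂μ := by
          refine setIntegral_mono_on (integrableOn_const measure_closedBall_lt_top.ne)
            (hint.mono_set hsub) measurableSet_closedBall fun x hx => ?_
          have hx4 : ‖x‖ ≤ 1 / 4 := by simpa using hx
          gcongr
          nlinarith [norm_nonneg x]
      _ ≤ _ := by
          refine setIntegral_mono_set hint ?_ hsub.eventuallyLE
          filter_upwards [ae_restrict_mem measurableSet_closedBall] with x hx
          have hx2 : ‖x‖ ≤ 2 := by simpa using hx
          have : 0 ≤ 9 - ‖x‖ ^ 2 := by nlinarith [norm_nonneg x]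
          exact pow_nonneg this N
  have hvol : 0 < μ.real (closedBall (0 : E) (1 / 4)) :=
    ENNReal.toReal_pos (measure_closedBall_pos μ 0 (by norm_num)).ne' measure_closedBall_lt_top.ne
  obtain ⟨N, hN⟩ := pow_unbounded_of_one_lt
    (M * μ.real (closedBall (0 : E) 2) / μ.real (closedBall (0 : E) (1 / 4)))
    (by norm_num : (1 : ℝ) < 143 / 140)
  have hkey := (hlower N).trans ((integral_pow_sub_norm_sq_mul_det_eq μ hV hR 9 N).symm.le.trans
    (hupper N))
  rw [div_lt_iff₀ hvol] at hN
  have hsplit : (143 / 16 : ℝ) ^ N = (143 / 140) ^ N * (35 / 4) ^ N := by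
    rw [← mul_pow]; norm_num
  rw [hsplit] at hkey
  have hpow : (0 : ℝ) < (35 / 4) ^ N := by positivity
  nlinarith

/-! ### Invariance of dimension -/

open Metric in
/-- Invariance of dimension: there is no continuous injection into a space of smaller dimension.
On a ball, such an `f` has a continuous left inverse `g`. With `C¹` approximations `f'` of `f` and
`P` of `g`, the map `P ∘ f'` is close to the identity, but its derivative factors through the
smaller space and is singular everywhere. -/
theorem not_injective_of_continuous_of_finrank_lt {E F : Type*} [NormedAddCommGroup E]
    [InnerProductSpace ℝ E] [FiniteDimensional ℝ E] [NormedAddCommGroup F] [NormedSpace ℝ F]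
    [FiniteDimensional ℝ F] (hdim : Module.finrank ℝ F < Module.finrank ℝ E) {f : E → F}
    (hf : Continuous f) : ¬ Function.Injective f := by
  intro hinj
  have hB : IsCompact (closedBall (0 : E) 2) := isCompact_closedBall _ _
  have : CompactSpace (closedBall (0 : E) 2) := isCompact_iff_compactSpace.1 hB
  have hemb : Topology.IsClosedEmbedding fun x : closedBall (0 : E) 2 => f x :=
    (hf.comp continuous_subtype_val).isClosedEmbedding (hinj.comp Subtype.val_injective)
  obtain ⟨g, hg⟩ := ContinuousMap.exists_extension' hemb
    (⟨Subtype.val, continuous_subtype_val⟩ : C(closedBall (0 : E) 2, E))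
  have hgf : ∀ x, ‖x‖ ≤ 2 → g (f x) = x := fun x hx =>
    congrFun hg ⟨x, by simpa using hx⟩
  obtain ⟨P, hP, hPg, -⟩ := g.continuous.exists_contDiff_approx 1
    (continuous_const (y := (1 / 4 : ℝ))) fun _ => by norm_num
  -- `f'` has to approximate `f` so closely that `P ∘ f'` is within `1/4` of `P ∘ f`.
  have hunif := (hB.image hf).uniformContinuousAt_of_continuousAt P
    (fun _ _ => hP.continuous.continuousAt) (dist_mem_uniformity (by norm_num : (0 : ℝ) < 1 / 4))
  obtain ⟨δ, hδ, hunif⟩ := mem_uniformity_dist.1 hunif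
  obtain ⟨f', hf', hff', -⟩ := hf.exists_contDiff_approx 1 (continuous_const (y := δ)) fun _ => hδ
  have hdP := hP.differentiable one_ne_zero
  have hdf := hf'.differentiable one_ne_zero
  obtain ⟨x, -, hx⟩ := exists_det_fderiv_ne_zero_of_norm_sub_le (hP.comp hf') fun x hx => by
    have h1 : dist (P (f x)) (P (f' x)) < 1 / 4 :=
      hunif ((dist_comm _ _).trans_lt (hff' x)) ⟨x, by simpa using hx, rfl⟩
    have h2 := hPg (f x)
    rw [hgf x hx] at h2
    rw [← dist_eq_norm]
    have h3 := dist_triangle_left (P (f' x)) x (P (f x))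
    simp only [Function.comp_apply]
    linarith
  refine hx ?_
  rw [fderiv_comp x (hdP _) (hdf _)]
  have hker : LinearMap.ker (fderiv ℝ f' x : E →ₗ[ℝ] F) ≠ ⊥ :=
    LinearMap.ker_ne_bot_of_finrank_lt hdim
  exact LinearMap.det_eq_zero_iff_ker_ne_bot.2 fun h =>
    hker (le_bot_iff.1 (h ▸ LinearMap.ker_le_ker_comp _ _))

/-! ### Injectivity of the state map -/

/-- If a non-zero polynomial multiple of `G` is a polynomial, then `G` is rational. The
denominator may vanish at `0`: a power of `X` is cancelled from both sides. -/
theorem PowerSeries.exists_isRationalOfDegreeLE_of_coeff_mul_eq_zero {G : PowerSeries ℝ}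
    {W : Polynomial ℝ} (hW : W ≠ 0) {n : ℕ}
    (h : ∀ s, n ≤ s → PowerSeries.coeff s ((W : PowerSeries ℝ) * G) = 0) :
    ∃ d : ℕ, G.IsRationalOfDegreeLE d := by
  obtain ⟨Q, hWQ, hQ⟩ := Polynomial.exists_eq_pow_rootMultiplicity_mul_and_not_dvd W hW 0
  rw [Polynomial.C_0, sub_zero] at hWQ hQ
  generalize Polynomial.rootMultiplicity 0 W = m at hWQ
  have hQG : ∀ s, n ≤ s → PowerSeries.coeff s ((Q : PowerSeries ℝ) * G) = 0 := by
    intro s hs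
    rw [← h (s + m) (by omega), hWQ, Polynomial.coe_mul, Polynomial.coe_pow, Polynomial.coe_X,
      mul_assoc, PowerSeries.coeff_X_pow_mul]
  refine ⟨max n Q.natDegree, PowerSeries.trunc n ((Q : PowerSeries ℝ) * G), Q,
    fun h0 => hQ (Polynomial.X_dvd_iff.2 h0), ?_, ?_, ?_⟩
  · exact Polynomial.degree_le_natDegree.trans (by exact_mod_cast le_max_right _ _)
  · exact (PowerSeries.degree_trunc_lt _ _).trans_le (by exact_mod_cast le_max_left _ _)
  · ext s
    rw [Polynomial.coeff_coe, PowerSeries.coeff_trunc]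
    split_ifs with hs
    · rfl
    · exact hQG s (not_lt.1 hs)

theorem hasSum_toeplitz_mul (a z : ℕ → ℝ) (t : ℕ) :
    HasSum (fun j => toeplitz a t j * z j) (∑ j ∈ Finset.range (t + 1), a (t - j) * z j) := by
  have h : ∑ j ∈ Finset.range (t + 1), a (t - j) * z j =
      ∑ j ∈ Finset.range (t + 1), toeplitz a t j * z j :=
    Finset.sum_congr rfl fun j hj => by
      simp [toeplitz, Nat.le_of_lt_succ (Finset.mem_range.1 hj)]
  rw [h]
  refine hasSum_sum_of_ne_finset_zero fun j hj => ?_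
  have : ¬ j ≤ t := fun hjt => hj (Finset.mem_range.2 (Nat.lt_succ_of_le hjt))
  simp [toeplitz, this]

theorem coeff_mk_mul_mk_eq_sum_range (a z : ℕ → ℝ) (t : ℕ) :
    PowerSeries.coeff t (PowerSeries.mk z * PowerSeries.mk a) =
      ∑ j ∈ Finset.range (t + 1), a (t - j) * z j := by
  rw [PowerSeries.coeff_mul, Finset.Nat.sum_antidiagonal_eq_sum_range_succ_mk]
  simp [mul_comm]

namespace StreamingMaps

theorem state_eq_of_state_eq_of_forall_lt {A : StreamingMaps} {z z' : ℕ → ℝ} {t s : ℕ}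
    (hts : t ≤ s) (h : A.state z t = A.state z' t) (hz : ∀ i, t < i → z i = z' i) :
    A.state z s = A.state z' s := by
  induction s, hts using Nat.le_induction with
  | base => exact h
  | succ s hs ih =>
    change A.update (s + 1) (A.state z s) (z (s + 1)) =
      A.update (s + 1) (A.state z' s) (z' (s + 1))
    rw [ih, hz (s + 1) (by omega)]

end StreamingMaps

namespace StreamingAlgorithm

open StreamingMaps in
/-- Two inputs with the same state at time `t`, both continued by zeros, give equal outputs from
then on. Their difference is the coefficient sequence of a polynomial `W` of degree at most `t`,
and `W * G[a]` has no terms of degree `t` or more. -/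
theorem injective_state_of_solvesUpTo_toeplitz {a : ℕ → ℝ}
    (ha : (PowerSeries.mk a).IsIrrational) {A : StreamingAlgorithm}
    (hA : A.SolvesUpTo (toeplitz a) ⊤) (t : ℕ) :
    Function.Injective fun z : Fin (t + 1) → ℝ => A.state (extendByZero z) t := by
  intro z z' hzz'
  by_contra hne
  have htail : ∀ (y : Fin (t + 1) → ℝ) (i : ℕ), t < i → extendByZero y i = 0 := fun y i hi => by
    simp [extendByZero, show ¬ i < t + 1 by omega]
  let w : ℕ → ℝ := fun i => extendByZero z i - extendByZero z' i
  let W : Polynomial ℝ := PowerSeries.trunc (t + 1) (PowerSeries.mk w)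
  have hWw : (W : PowerSeries ℝ) = PowerSeries.mk w := by
    ext i
    rw [Polynomial.coeff_coe, PowerSeries.coeff_trunc, PowerSeries.coeff_mk]
    split_ifs with hi
    · rfl
    · simp [w, htail _ i (by omega : t < i)]
  have hW : W ≠ 0 := by
    intro h0
    apply hne
    funext i
    have : PowerSeries.coeff (i : ℕ) (W : PowerSeries ℝ) = 0 := by simp [h0]
    rw [hWw, PowerSeries.coeff_mk] at this
    simpa [w, extendByZero, sub_eq_zero, i.is_le] using this
  refine ha (PowerSeries.exists_isRationalOfDegreeLE_of_coeff_mul_eq_zero hW (n := t)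
    fun s hs => ?_)
  have hstate := state_eq_of_state_eq_of_forall_lt hs hzz' fun i hi => by
    rw [htail _ i hi, htail _ i hi]
  have h1 := hA (extendByZero z) s le_top
  have h2 := hA (extendByZero z') s le_top
  rw [← hstate] at h2
  have h3 := (h1.unique (hasSum_toeplitz_mul _ _ _)).symm.trans
    (h2.unique (hasSum_toeplitz_mul _ _ _))
  rw [hWw, coeff_mk_mul_mk_eq_sum_range]
  simp only [w, mul_sub, Finset.sum_sub_distrib, h3, sub_self]

theorem succ_le_bufferSize_of_solvesUpTo_toeplitz {a : ℕ → ℝ}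
    (ha : (PowerSeries.mk a).IsIrrational) {A : StreamingAlgorithm}
    (hA : A.SolvesUpTo (toeplitz a) ⊤) (t : ℕ) : t + 1 ≤ A.bufferSize t := by
  by_contra! hlt
  refine not_injective_of_continuous_of_finrank_lt (E := EuclideanSpace ℝ (Fin (t + 1)))
    (F := Fin (A.bufferSize t) → ℝ) (by simpa using hlt)
    ((A.continuous_state t).comp (PiLp.continuous_ofLp 2 _)) ?_
  exact (injective_state_of_solvesUpTo_toeplitz ha hA t).comp (WithLp.ofLp_injective 2)

end StreamingAlgorithm

/-! ### The algorithm that stores the stream -/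

/-- The maps that append each input to the buffer, so that the state at time `t` is
`(z_0, …, z_t)`, and output the `t`-th entry of `T[a] z`. -/
def storeAllMaps (a : ℕ → ℝ) : StreamingMaps where
  bufferSize t := t + 1
  update t s x := fun i =>
    if h : (i : ℕ) < t then s ⟨i, by cases t with
      | zero => omega
      | succ t => exact h⟩
    else x
  output t s := ∑ j : Fin (t + 1), a (t - j) * s j

theorem storeAllMaps_state (a z : ℕ → ℝ) (t : ℕ) :
    (storeAllMaps a).state z t = fun i : Fin (t + 1) => z i := by
  induction t with
  | zero =>
    funext i
    have hi : (i : ℕ) = 0 := by have : (i : ℕ) < 0 + 1 := i.2; omega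
    simp [StreamingMaps.state, storeAllMaps, hi]
  | succ t ih =>
    change (storeAllMaps a).update (t + 1) ((storeAllMaps a).state z t) (z (t + 1)) = _
    rw [ih]
    funext i
    by_cases h : (i : ℕ) < t + 1
    · simp [storeAllMaps, h]
    · have hi : (i : ℕ) = t + 1 := by have : (i : ℕ) < t + 1 + 1 := i.2; omega
      simp [storeAllMaps, hi]

/-- The streaming algorithm that stores the whole stream, with `t + 1` numbers at time `t`. -/
def storeAll (a : ℕ → ℝ) : StreamingAlgorithm where
  toStreamingMaps := storeAllMaps a
  continuous_state t := by
    simp only [storeAllMaps_state]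
    refine continuous_pi fun i : Fin (t + 1) => ?_
    have : (fun z : Fin (t + 1) → ℝ => StreamingMaps.extendByZero z i) = fun z => z i := by
      funext z
      exact dif_pos i.isLt
    rw [this]
    exact continuous_apply i

theorem storeAll_solvesUpTo (a : ℕ → ℝ) : (storeAll a).SolvesUpTo (toeplitz a) ⊤ := by
  intro z t _
  have h : (storeAll a).output t ((storeAll a).state z t) =
      ∑ j ∈ Finset.range (t + 1), a (t - j) * z j := by
    rw [show (storeAll a).state z t = _ from storeAllMaps_state a z t]
    exact Fin.sum_univ_eq_sum_range (fun j => a (t - j) * z j) (t + 1)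
  rw [h]
  exact hasSum_toeplitz_mul a z t

theorem theorem2 (a : ℕ → ℝ) (ha : (PowerSeries.mk a).IsIrrational) :
    (∀ t : ℕ, streamSpace (toeplitz a) t ⊤ = (t : ℕ∞) + 1) ∧
    (∀ A : StreamingAlgorithm, A.SolvesUpTo (toeplitz a) ⊤ →
      ¬ ∃ B : ℕ, ∀ t : ℕ, A.bufferSize t ≤ B) := by
  refine ⟨fun t => le_antisymm (sInf_le ?_) (le_sInf ?_), ?_⟩
  · refine ⟨storeAll a, storeAll_solvesUpTo a, fun t' ht' => ?_⟩
    change ((t' + 1 : ℕ) : ℕ∞) ≤ t + 1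
    exact_mod_cast Nat.succ_le_succ ht'
  · rintro b ⟨A, hA, hb⟩
    refine le_trans ?_ (hb t le_rfl)
    exact_mod_cast A.succ_le_bufferSize_of_solvesUpTo_toeplitz ha hA t
  · rintro A hA ⟨B, hB⟩
    exact absurd ((A.succ_le_bufferSize_of_solvesUpTo_toeplitz ha hA B).trans (hB B)) (by omega)
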